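/- Let $n\in\{1,2,\dots\}$, let $F^2(H_n)=\bigoplus_{k\ge 0}H_n^{\otimes k}$ be the full Fock space of an $n$-dimensional complex Hilbert space $H_n$ with orthonormal basis $e_1,\dots,e_n$, let $S_i\varphi=e_i\otimes\varphi$ be the left creation operators on it, and let $C^*(S_1,\dots,S_n)$ be the Cuntz–Toeplitz algebra, i.e. the unital norm-closed $*$-algebra they generate. Let $\mathbb F_n^+$ be the unital free semigroup on generators $g_1,\dots,g_n$. For a word $\alpha=g_{i_1}\cdots g_{i_k}$ write $|\alpha|=k$, $S_\alpha=S_{i_1}\cdots S_{i_k}$, $T_\alpha=T_{i_1}\cdots T_{i_k}$, $r_\alpha=r_{i_1}\cdots r_{i_k}$; for the empty word the product is the identity, and its coefficient is written $a_0$. For a complex Hilbert space $\mathcal K$ and $r\ge 0$ let $[B(\mathcal K)^n]_r$ be the set of $(T_1,\dots,T_n)\in B(\mathcal K)^n$ with $\|T_1T_1^*+\cdots+T_nT_n^*\|^{1/2}\le r$. For $m\ge 2$ and $s\geq 0$ put $$f_m(s)=\sum_{k=1}^{m-1}s^k\cos\frac{\pi}{\left[\frac{m-1}{k}\right]+2},$$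 where $[x]$ is the integer part of $x$. **Theorem 1.8.** For every $m\ge2$ the equation $f_m(s)=1$ has a unique positive solution $\gamma_m$, and the equation $f_m(s)=\frac12$ has a unique positive solution $t_m$. Here $\gamma_2=2$, $\gamma_m\in(0,1]$ for $m\ge3$, and $t_m\in(0,1]$ for $m\ge2$. The sequence $\{\gamma_m\}_{m\ge2}$ is strictly decreasing and converges to $\frac12$; the sequence $\{t_m\}_{m\ge2}$ is strictly decreasing and converges to $\frac13$. Let $m\ge 2$, $a_\alpha\in\mathbb C$, and let $$H(S_1,\dots,S_n)=\sum_{1\le|\alpha|\le m-1}\overline{a}_\alpha S_\alpha^*+a_0I+\sum_{1\le|\alpha|\le m-1}a_\alpha S_\alpha$$ be a selfadjoint element of $C^*(S_1,\dots,S_n)$ with $\|H(S_1,\dots,S_n)\|\le1$. Then: (i) $\displaystyle\Big(\sum_{|\alpha|=k}|a_\alpha|^2\Big)^{1/2}\le(1-|a_0|)\cos\frac{\pi}{\left[\frac{m-1}{k}\right]+2}$ for $1\le k\le m-1$. (ii) $\displaystyle\sum_{k=0}^{m-1}\Big\|\sum_{|\alpha|=k}|a_\alpha|T_\alpha\Big\|\le1$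 for every complex Hilbert space $\mathcal K$ and every $(T_1,\dots,T_n)\in[B(\mathcal K)^n]_{\gamma_m}$. (iii) $\displaystyle\sum_{k=1}^{m-1}\Big\|\sum_{|\alpha|=k}|\overline{a}_\alpha|T_\alpha^*\Big\|+|a_0|+\sum_{k=1}^{m-1}\Big\|\sum_{|\alpha|=k}|a_\alpha|T_\alpha\Big\|\le1$ for every complex Hilbert space $\mathcal K$ and every $(T_1,\dots,T_n)\in[B(\mathcal K)^n]_{t_m}$, where $T_\alpha^*=(T_\alpha)^*$. In particular, for real numbers $r_1,\dots,r_n\ge0$: (iv) $\displaystyle\sum_{k=0}^{m-1}\sum_{|\alpha|=k}|a_\alpha|r_\alpha\le1$ if $\|(r_1,\dots,r_n)\|_2\le\gamma_m$; (v) $\displaystyle|a_0|+2\sum_{k=1}^{m-1}\sum_{|\alpha|=k}|a_\alpha|r_\alpha\le1$ if $\|(r_1,\dots,r_n)\|_2\le t_m$. -/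

import Mathlib

open scoped ComplexConjugate InnerProductSpace

noncomputable section

/-- The words of length `k` in the unital free semigroup on `n` generators (its neutral element,
the empty word, is `1`). -/
def wordsOfLength (n k : ℕ) : Finset (FreeMonoid (Fin n)) :=
  (List.finite_length_eq (Fin n) k).toFinset

theorem mem_wordsOfLength {n k : ℕ} {α : FreeMonoid (Fin n)} :
    α ∈ wordsOfLength n k ↔ α.length = k := by
  unfold wordsOfLength
  exact Set.Finite.mem_toFinset _

/-- `T_α = T_{i₁} T_{i₂} ⋯ T_{iₖ}` for the word `α = g_{i₁} g_{i₂} ⋯ g_{iₖ}`, and `T_α = 1` for the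
empty word. -/
def wordProd {M : Type*} [Monoid M] {n : ℕ} (T : Fin n → M) (α : FreeMonoid (Fin n)) : M :=
  FreeMonoid.lift T α

/-- The full Fock space of an `n`-dimensional Hilbert space with orthonormal basis `e₁, …, eₙ`,
in the orthonormal basis of the elementary tensors `e_α = e_{i₁} ⊗ ⋯ ⊗ e_{iₖ}`, indexed by the words
`α` (with the vacuum vector for the empty word): the Hilbert space `ℓ²` of the free semigroup. -/
abbrev FockSpace (n : ℕ) : Type := lp (fun _ : FreeMonoid (Fin n) => ℂ) 2

open Classical in
/-- The basis vector `e_α` of the full Fock space. -/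
def fockBasis {n : ℕ} (α : FreeMonoid (Fin n)) : FockSpace n :=
  lp.single 2 α (1 : ℂ)

theorem orthonormal_fockBasis (n : ℕ) :
    Orthonormal ℂ (fockBasis : FreeMonoid (Fin n) → FockSpace n) := by
  classical
  rw [orthonormal_iff_ite]
  intro α β
  simp only [fockBasis, lp.inner_single_left, lp.single_apply]
  by_cases h : α = β
  · subst h; simp
  · simp [h]

theorem orthonormal_fockBasis_mul {n : ℕ} (i : Fin n) :
    Orthonormal ℂ (fun α : FreeMonoid (Fin n) => fockBasis (FreeMonoid.of i * α)) :=
  (orthonormal_fockBasis n).comp _ (fun _ _ h => mul_left_cancel h)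

/-- The left creation operator `φ ↦ eᵢ ⊗ φ` on the full Fock space: the isometry that sends
`e_α` to `e_{gᵢ α}` for every word `α`. -/
def creation {n : ℕ} (i : Fin n) : FockSpace n →L[ℂ] FockSpace n :=
  (orthonormal_fockBasis_mul i).orthogonalFamily.linearIsometry.toContinuousLinearMap

theorem creation_fockBasis {n : ℕ} (i : Fin n) (α : FreeMonoid (Fin n)) :
    creation i (fockBasis α) = fockBasis (FreeMonoid.of i * α) := by
  classical
  have h := (orthonormal_fockBasis_mul i).orthogonalFamily.linearIsometry_apply_single
    (i := α) (1 : ℂ)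
  rw [LinearIsometry.toSpanSingleton_apply, one_smul] at h
  exact h

/-- The Cuntz–Toeplitz algebra `C*(S₁, …, Sₙ)`: the norm closed unital star-subalgebra generated by
the left creation operators. -/
abbrev CuntzToeplitz (n : ℕ) : StarSubalgebra ℂ (FockSpace n →L[ℂ] FockSpace n) :=
  (StarAlgebra.adjoin ℂ
    (Set.range (creation : Fin n → FockSpace n →L[ℂ] FockSpace n))).topologicalClosure

/-- The generator `Sᵢ` of the Cuntz–Toeplitz algebra. -/
def ctGen {n : ℕ} (i : Fin n) : CuntzToeplitz n :=
  ⟨creation i, StarSubalgebra.le_topologicalClosure _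
    (StarAlgebra.subset_adjoin ℂ _ (Set.mem_range_self i))⟩

/-- The element `∑_{1≤|α|≤m-1} ā_α S_α^* + a₀ I + ∑_{1≤|α|≤m-1} a_α S_α` of the Cuntz–Toeplitz
algebra. -/
def harmonicPoly {n : ℕ} (m : ℕ) (a : FreeMonoid (Fin n) → ℂ) : CuntzToeplitz n :=
  (∑ k ∈ Finset.Icc 1 (m - 1), ∑ α ∈ wordsOfLength n k, conj (a α) • star (wordProd ctGen α))
    + a 1 • (1 : CuntzToeplitz n)
    + ∑ k ∈ Finset.Icc 1 (m - 1), ∑ α ∈ wordsOfLength n k, a α • wordProd ctGen α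

/-- The closed ball `[B(K)ⁿ]_r`: the `n`-tuples of bounded operators on `K` with
`‖T₁T₁^* + ⋯ + TₙTₙ^*‖^{1/2} ≤ r`. -/
def rowBall {n : ℕ} (K : Type*) [NormedAddCommGroup K] [InnerProductSpace ℂ K] [CompleteSpace K]
    (r : ℝ) : Set (Fin n → K →L[ℂ] K) :=
  {T | √‖∑ i, T i * star (T i)‖ ≤ r}

/-- `cos (π / ([(m-1)/k] + 2))`, where `[x]` is the integer part of `x` (the division of natural
numbers below rounds down). -/
def fejerCos (m k : ℕ) : ℝ :=
  Real.cos (Real.pi / (((m - 1) / k : ℕ) + 2))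

/-- `∑_{k=1}^{m-1} s^k cos (π / ([(m-1)/k] + 2))`. -/
def fejerSum (m : ℕ) (s : ℝ) : ℝ :=
  ∑ k ∈ Finset.Icc 1 (m - 1), s ^ k * fejerCos m k

end

open scoped ComplexConjugate InnerProductSpace

/-! Everything rests on the coefficient bound `sqrt_sum_coeff_le`. For a degree `k` whose
coefficient vector has norm `β > 0`, normalise it, up to a sign `ε`, to a unit tensor `q`. The
tensor powers `q^{⊗ j}` are orthonormal in Fock space. Since `‖H‖ ≤ 1` and `H` is selfadjoint,
compressing `I + εH` to these vectors gives a positive matrix with diagonal `1 + εa₀` and adjacent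
diagonals `β`. It vanishes beyond distance `d = [(m-1)/k]`, because `H` shifts degree by at most `m
- 1`. Fejér's inequality `fejer_coeff_le` then gives `β ≤ (1 + εa₀) cos (π/(d+2))`, and the better
sign turns `1 + εa₀` into `1 - |a₀|`.

On the ball of radius `s`, a Cauchy–Schwarz estimate (`norm_sum_smul_wordProd_le`) bounds the
degree-`k` part by `β s^k`. Summing over `k ≥ 1` gives at most `(1 - |a₀|) f_m(s)`, and `γ_m`, `t_m`
are the radii where `f_m` equals `1` and `1/2`. Their behaviour follows from monotonicity of
`f_m(s)` in `s` and `m` and from its limit `s/(1-s)` for `0 < s < 1`. -/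

/-! ### The roots of `fejerSum m s = c`. -/

theorem half_le_fejerCos {m k : ℕ} (hk : 1 ≤ k) (hkm : k ≤ m - 1) : 1 / 2 ≤ fejerCos m k := by
  have h1 : 1 ≤ (m - 1) / k := (Nat.one_le_div_iff hk).2 hkm
  have h2 : (1 : ℝ) ≤ (((m - 1) / k : ℕ) : ℝ) := by exact_mod_cast h1
  rw [← Real.cos_pi_div_three, fejerCos]
  apply Real.cos_le_cos_of_nonneg_of_le_pi (by positivity)
  · linarith [Real.pi_pos]
  · exact div_le_div_of_nonneg_left Real.pi_pos.le (by norm_num) (by linarith)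

theorem fejerCos_pos {m k : ℕ} (hk : 1 ≤ k) (hkm : k ≤ m - 1) : 0 < fejerCos m k :=
  lt_of_lt_of_le (by norm_num) (half_le_fejerCos hk hkm)

theorem fejerCos_mono {m m' : ℕ} (h : m ≤ m') (k : ℕ) : fejerCos m k ≤ fejerCos m' k := by
  have h1 : (((m - 1) / k : ℕ) : ℝ) ≤ (((m' - 1) / k : ℕ) : ℝ) := by
    exact_mod_cast Nat.div_le_div_right (by omega)
  rw [fejerCos, fejerCos]
  apply Real.cos_le_cos_of_nonneg_of_le_pi (by positivity)
  · exact div_le_self Real.pi_pos.le (by linarith [Nat.cast_nonneg (α := ℝ) ((m - 1) / k)])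
  · exact div_le_div_of_nonneg_left Real.pi_pos.le (by positivity) (by linarith)

theorem tendsto_fejerCos {k : ℕ} (hk : 1 ≤ k) :
    Filter.Tendsto (fun m => fejerCos m k) Filter.atTop (nhds 1) := by
  have h1 : Filter.Tendsto (fun m : ℕ => (m - 1) / k) Filter.atTop Filter.atTop :=
    (Nat.tendsto_div_const_atTop (by omega)).comp (Filter.tendsto_sub_atTop_nat 1)
  have h2 : Filter.Tendsto (fun m : ℕ => Real.pi / ((((m - 1) / k : ℕ) : ℝ) + 2))
      Filter.atTop (nhds 0) :=
    Filter.Tendsto.const_div_atTop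
      (Filter.tendsto_atTop_add_const_right _ _ (tendsto_natCast_atTop_atTop.comp h1)) _
  have h3 := (Real.continuous_cos.tendsto 0).comp h2
  rw [Real.cos_zero] at h3
  exact h3

theorem continuous_fejerSum (m : ℕ) : Continuous (fejerSum m) := by
  unfold fejerSum
  fun_prop

theorem strictMonoOn_fejerSum {m : ℕ} (hm : 2 ≤ m) :
    StrictMonoOn (fejerSum m) (Set.Ici 0) := by
  intro s hs t _ hst
  apply Finset.sum_lt_sum_of_nonempty ⟨1, by simp; omega⟩
  intro k hk
  rw [Finset.mem_Icc] at hk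
  exact mul_lt_mul_of_pos_right (pow_lt_pow_left₀ hst hs (by omega)) (fejerCos_pos hk.1 hk.2)

theorem half_le_fejerSum {m : ℕ} (hm : 2 ≤ m) {s : ℝ} (hs : 0 ≤ s) : s / 2 ≤ fejerSum m s := by
  have h := Finset.single_le_sum (f := fun k => s ^ k * fejerCos m k) (s := Finset.Icc 1 (m - 1))
    (fun k hk => by
      rw [Finset.mem_Icc] at hk
      exact mul_nonneg (pow_nonneg hs k) (fejerCos_pos hk.1 hk.2).le)
    (a := 1) (by simp; omega)
  have h1 := half_le_fejerCos (m := m) (k := 1) le_rfl (by omega)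
  simp only [pow_one] at h
  unfold fejerSum
  nlinarith

theorem fejerSum_strictMono {m m' : ℕ} (hm : 1 ≤ m) (h : m < m') {s : ℝ} (hs : 0 < s) :
    fejerSum m s < fejerSum m' s := by
  have hsub : Finset.Icc 1 (m - 1) ⊆ Finset.Icc 1 (m' - 1) :=
    Finset.Icc_subset_Icc le_rfl (by omega)
  calc fejerSum m s ≤ ∑ k ∈ Finset.Icc 1 (m - 1), s ^ k * fejerCos m' k :=
        Finset.sum_le_sum fun k _ =>
          mul_le_mul_of_nonneg_left (fejerCos_mono h.le k) (pow_nonneg hs.le k)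
    _ < fejerSum m' s := by
        have hmem : m ∈ Finset.Icc 1 (m' - 1) := by rw [Finset.mem_Icc]; omega
        -- Strictness comes from the index `m`, which only the longer sum contains.
        refine Finset.sum_lt_sum_of_subset hsub hmem (by rw [Finset.mem_Icc]; omega) ?_ ?_
        · rw [Finset.mem_Icc] at hmem
          exact mul_pos (pow_pos hs m) (fejerCos_pos hmem.1 hmem.2)
        · intro k hk _
          rw [Finset.mem_Icc] at hk
          exact mul_nonneg (pow_nonneg hs.le k) (fejerCos_pos hk.1 hk.2).le

theorem fejerSum_zero (m : ℕ) : fejerSum m 0 = 0 := by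
  refine Finset.sum_eq_zero fun k hk => ?_
  rw [Finset.mem_Icc] at hk
  rw [zero_pow (by omega), zero_mul]

theorem exists_fejerSum_eq {m : ℕ} (hm : 2 ≤ m) {c : ℝ} (hc : 0 < c) :
    ∃ s, 0 < s ∧ fejerSum m s = c := by
  have h := intermediate_value_Icc (f := fejerSum m) (a := 0) (b := 2 * c) (by positivity)
    (continuous_fejerSum m).continuousOn
  obtain ⟨s, hs, hsc⟩ := h (show c ∈ _ from
    ⟨by rw [fejerSum_zero]; exact hc.le, by
      have := half_le_fejerSum hm (s := 2 * c) (by positivity)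
      linarith⟩)
  refine ⟨s, lt_of_le_of_ne hs.1 ?_, hsc⟩
  rintro rfl
  rw [fejerSum_zero] at hsc
  exact hc.ne hsc

open Classical in
/-- The positive solution of `fejerSum m s = c`. -/
noncomputable def fejerRoot (c : ℝ) (m : ℕ) : ℝ :=
  if h : 2 ≤ m ∧ 0 < c then (exists_fejerSum_eq h.1 h.2).choose else 0

theorem fejerRoot_spec {c : ℝ} (hc : 0 < c) {m : ℕ} (hm : 2 ≤ m) :
    0 < fejerRoot c m ∧ fejerSum m (fejerRoot c m) = c := by
  rw [fejerRoot, dif_pos ⟨hm, hc⟩]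
  exact (exists_fejerSum_eq hm hc).choose_spec

theorem eq_fejerRoot {c : ℝ} (hc : 0 < c) {m : ℕ} (hm : 2 ≤ m) {s : ℝ} (hs : 0 < s)
    (h : fejerSum m s = c) : s = fejerRoot c m :=
  (strictMonoOn_fejerSum hm).injOn hs.le (fejerRoot_spec hc hm).1.le
    (h.trans (fejerRoot_spec hc hm).2.symm)

theorem fejerRoot_le {c : ℝ} (hc : 0 < c) {m : ℕ} (hm : 2 ≤ m) {s : ℝ} (hs : 0 ≤ s)
    (h : c ≤ fejerSum m s) : fejerRoot c m ≤ s := by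
  rw [← (strictMonoOn_fejerSum hm).le_iff_le (fejerRoot_spec hc hm).1.le hs,
    (fejerRoot_spec hc hm).2]
  exact h

theorem lt_fejerRoot {c : ℝ} (hc : 0 < c) {m : ℕ} (hm : 2 ≤ m) {s : ℝ} (hs : 0 ≤ s)
    (h : fejerSum m s < c) : s < fejerRoot c m := by
  rw [← (strictMonoOn_fejerSum hm).lt_iff_lt hs (fejerRoot_spec hc hm).1.le,
    (fejerRoot_spec hc hm).2]
  exact h

theorem strictAntiOn_fejerRoot {c : ℝ} (hc : 0 < c) :
    StrictAntiOn (fejerRoot c) (Set.Ici 2) := by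
  intro m hm m' hm' h
  rw [Set.mem_Ici] at hm hm'
  refine lt_fejerRoot hc hm (fejerRoot_spec hc hm').1.le ?_
  calc _ < _ := fejerSum_strictMono (by omega) h (fejerRoot_spec hc hm').1
    _ = c := (fejerRoot_spec hc hm').2

theorem sum_Icc_pow_succ (s : ℝ) (N : ℕ) :
    (∑ k ∈ Finset.Icc 1 N, s ^ k) * (1 - s) = s - s ^ (N + 1) := by
  induction N with
  | zero => simp
  | succ N ih => rw [Finset.sum_Icc_succ_top (by omega), add_mul, ih]; ring

theorem fejerSum_lt {m : ℕ} {s : ℝ} (hs : 0 < s) (hs1 : s < 1) : fejerSum m s < s / (1 - s) := by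
  have h1 : fejerSum m s ≤ ∑ k ∈ Finset.Icc 1 (m - 1), s ^ k :=
    Finset.sum_le_sum fun k _ => mul_le_of_le_one_right (pow_nonneg hs.le k) (Real.cos_le_one _)
  refine h1.trans_lt ?_
  rw [lt_div_iff₀ (by linarith), sum_Icc_pow_succ]
  linarith [pow_pos hs (m - 1 + 1)]

/-- A fixed partial sum of the geometric series already exceeds `c`; each cosine in that finite
range tends to `1` with `m`. -/
theorem eventually_lt_fejerSum {c s : ℝ} (hs : 0 < s) (hs1 : s < 1) (h : c < s / (1 - s)) :
    ∀ᶠ m in Filter.atTop, c < fejerSum m s := by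
  obtain ⟨N, hN⟩ : ∃ N : ℕ, c < ∑ k ∈ Finset.Icc 1 N, s ^ k := by
    have h0 : Filter.Tendsto (fun N : ℕ => (s - s ^ (N + 1)) / (1 - s)) Filter.atTop
        (nhds ((s - 0) / (1 - s))) :=
      (((tendsto_pow_atTop_nhds_zero_of_lt_one hs.le hs1).comp
        (Filter.tendsto_add_atTop_nat 1)).const_sub s).div_const _
    rw [sub_zero] at h0
    obtain ⟨N, hN⟩ := (h0.eventually (lt_mem_nhds h)).exists
    refine ⟨N, ?_⟩
    rwa [← sum_Icc_pow_succ, mul_div_cancel_right₀ _ (by linarith)] at hN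
  have h2 : Filter.Tendsto (fun m => ∑ k ∈ Finset.Icc 1 N, s ^ k * fejerCos m k) Filter.atTop
      (nhds (∑ k ∈ Finset.Icc 1 N, s ^ k * 1)) :=
    tendsto_finsetSum _ fun k hk => (tendsto_fejerCos (Finset.mem_Icc.1 hk).1).const_mul _
  simp only [mul_one] at h2
  filter_upwards [h2.eventually (lt_mem_nhds hN), Filter.eventually_ge_atTop (N + 1)] with m hm hmN
  refine hm.trans_le (Finset.sum_le_sum_of_subset_of_nonneg
    (Finset.Icc_subset_Icc le_rfl (by omega)) fun k hk _ => ?_)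
  rw [Finset.mem_Icc] at hk
  exact mul_nonneg (pow_nonneg hs.le k) (fejerCos_pos hk.1 hk.2).le

/-- The limit `c/(1+c)` solves `s/(1-s) = c`. It lies below every root because `f_m(s) < s/(1-s)`
strictly, while any larger `s < 1` eventually has `f_m(s) > c`. -/
theorem tendsto_fejerRoot {c : ℝ} (hc : 0 < c) :
    Filter.Tendsto (fejerRoot c) Filter.atTop (nhds (c / (1 + c))) := by
  have hL0 : 0 < c / (1 + c) := by positivity
  have hL1 : c / (1 + c) < 1 := by rw [div_lt_one (by positivity)]; linarith
  have hL : c / (1 + c) / (1 - c / (1 + c)) = c := by field_simp; ring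
  rw [tendsto_order]
  constructor
  · intro b hb
    filter_upwards [Filter.eventually_ge_atTop 2] with m hm
    exact hb.trans (lt_fejerRoot hc hm hL0.le ((fejerSum_lt hL0 hL1).trans_eq hL))
  · intro b hb
    obtain ⟨s, hs, hsb⟩ := exists_between (lt_min hb hL1)
    rw [lt_min_iff] at hsb
    have hs0 := hL0.trans hs
    have hcs : c < s / (1 - s) := by
      rw [lt_div_iff₀ (by linarith)]
      rw [div_lt_iff₀ (by positivity)] at hs
      linarith
    filter_upwards [Filter.eventually_ge_atTop 2, eventually_lt_fejerSum hs0 hsb.2 hcs] with m hm h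
    exact (fejerRoot_le hc hm hs0.le h.le).trans_lt hsb.1

/-- For `m ≥ 3` there are at least two terms, each at least `1/2`. -/
theorem one_le_fejerSum_one {m : ℕ} (hm : 3 ≤ m) : 1 ≤ fejerSum m 1 := by
  have h : ∑ k ∈ Finset.Icc 1 (m - 1), (1 / 2 : ℝ) ≤ fejerSum m 1 :=
    Finset.sum_le_sum fun k hk => by
      rw [Finset.mem_Icc] at hk
      rw [one_pow, one_mul]
      exact half_le_fejerCos hk.1 hk.2
  rw [Finset.sum_const, Nat.card_Icc, nsmul_eq_mul] at h
  have h2 : (2 : ℝ) ≤ ((m - 1 + 1 - 1 : ℕ) : ℝ) := by exact_mod_cast (by omega)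
  linarith

theorem fejerSum_two (s : ℝ) : fejerSum 2 s = s / 2 := by
  simp only [fejerSum, fejerCos]
  norm_num
  ring

/-! ### Sums over words. -/

theorem wordsOfLength_zero (n : ℕ) : wordsOfLength n 0 = {1} := by
  ext α
  rw [mem_wordsOfLength, Finset.mem_singleton]
  exact FreeMonoid.length_eq_zero

/-- Summation over the words of length `k + 1`, by the last letter. -/
theorem sum_wordsOfLength_succ {n : ℕ} {M : Type*} [AddCommMonoid M] (k : ℕ)
    (f : FreeMonoid (Fin n) → M) :
    ∑ α ∈ wordsOfLength n (k + 1), f α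
      = ∑ α ∈ wordsOfLength n k, ∑ i, f (α * FreeMonoid.of i) := by
  rw [← Finset.sum_product']
  symm
  refine Finset.sum_bij (fun p _ => p.1 * FreeMonoid.of p.2) ?_ ?_ ?_ fun _ _ => rfl
  · rintro ⟨α, i⟩ h
    rw [Finset.mem_product, mem_wordsOfLength] at h
    rw [mem_wordsOfLength, FreeMonoid.length_mul, h.1, FreeMonoid.length_of]
  · rintro ⟨α, i⟩ _ ⟨β, j⟩ _ h
    have h' : FreeMonoid.toList α ++ [i] = FreeMonoid.toList β ++ [j] := h
    obtain ⟨h1, h2⟩ := List.append_inj' h' rfl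
    exact Prod.ext h1 (List.singleton_inj.1 h2)
  · intro α hα
    rw [mem_wordsOfLength] at hα
    have hne : FreeMonoid.toList α ≠ [] := by
      rintro h
      have : α.length = 0 := by rw [FreeMonoid.length, h]; rfl
      omega
    refine ⟨(FreeMonoid.ofList (FreeMonoid.toList α).dropLast,
      (FreeMonoid.toList α).getLast hne), ?_, ?_⟩
    · rw [Finset.mem_product, mem_wordsOfLength]
      refine ⟨?_, Finset.mem_univ _⟩
      have : (FreeMonoid.toList α).length = k + 1 := hα
      change (FreeMonoid.toList α).dropLast.length = k
      rw [List.length_dropLast]; omega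
    · exact List.dropLast_append_getLast hne

theorem wordProd_one {M : Type*} [Monoid M] {n : ℕ} (T : Fin n → M) : wordProd T 1 = 1 :=
  map_one _

theorem wordProd_mul {M : Type*} [Monoid M] {n : ℕ} (T : Fin n → M) (α β : FreeMonoid (Fin n)) :
    wordProd T (α * β) = wordProd T α * wordProd T β :=
  map_mul _ _ _

theorem wordProd_of {M : Type*} [Monoid M] {n : ℕ} (T : Fin n → M) (i : Fin n) :
    wordProd T (FreeMonoid.of i) = T i :=
  FreeMonoid.lift_eval_of _ _

theorem map_wordProd {M N F : Type*} [Monoid M] [Monoid N] [FunLike F M N] [MonoidHomClass F M N]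
    (f : F) {n : ℕ} (T : Fin n → M) (α : FreeMonoid (Fin n)) :
    f (wordProd T α) = wordProd (fun i => f (T i)) α := by
  induction α using FreeMonoid.recOn with
  | one => simp only [wordProd_one, map_one]
  | of_mul i α ih => simp only [wordProd_mul, wordProd_of, map_mul, ih]

theorem sum_wordProd_sq {n : ℕ} (r : Fin n → ℝ) (k : ℕ) :
    ∑ α ∈ wordsOfLength n k, wordProd r α ^ 2 = (∑ i, r i ^ 2) ^ k := by
  induction k with
  | zero => rw [wordsOfLength_zero, Finset.sum_singleton, wordProd_one]; simp
  | succ k ih =>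
    rw [sum_wordsOfLength_succ, pow_succ, ← ih, Finset.sum_mul]
    refine Finset.sum_congr rfl fun α _ => ?_
    rw [Finset.mul_sum]
    exact Finset.sum_congr rfl fun i _ => by rw [wordProd_mul, wordProd_of, mul_pow]

theorem sum_mul_wordProd_le {n : ℕ} (r : EuclideanSpace ℝ (Fin n)) (c : FreeMonoid (Fin n) → ℝ)
    (k : ℕ) :
    ∑ α ∈ wordsOfLength n k, c α * wordProd (fun i => r i) α
      ≤ √(∑ α ∈ wordsOfLength n k, c α ^ 2) * ‖r‖ ^ k := by
  refine (Real.sum_mul_le_sqrt_mul_sqrt _ _ _).trans_eq ?_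
  have h : ∑ i, r i ^ 2 = ‖r‖ ^ 2 := by
    rw [EuclideanSpace.norm_sq_eq]
    exact Finset.sum_congr rfl fun i _ => by rw [Real.norm_eq_abs, sq_abs]
  rw [sum_wordProd_sq, h, ← pow_mul, mul_comm 2 k, pow_mul, Real.sqrt_sq (by positivity)]

/-! ### Norm estimates for homogeneous polynomials on the row ball. -/

section RowBall

variable {n : ℕ} {K : Type*} [NormedAddCommGroup K] [InnerProductSpace ℂ K] [CompleteSpace K]

theorem sum_norm_star_sq_le (T : Fin n → K →L[ℂ] K) (x : K) :
    ∑ i, ‖star (T i) x‖ ^ 2 ≤ ‖∑ i, T i * star (T i)‖ * ‖x‖ ^ 2 := by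
  have h : ((∑ i, ‖star (T i) x‖ ^ 2 : ℝ) : ℂ) = ⟪x, (∑ i, T i * star (T i)) x⟫_ℂ := by
    rw [sum_apply, inner_sum, Complex.ofReal_sum]
    refine Finset.sum_congr rfl fun i _ => ?_
    rw [mul_apply_eq_comp, ← ContinuousLinearMap.adjoint_inner_left,
      ← ContinuousLinearMap.star_eq_adjoint, inner_self_eq_norm_sq_to_K]
    simp
  have h2 : ‖((∑ i, ‖star (T i) x‖ ^ 2 : ℝ) : ℂ)‖ ≤ ‖∑ i, T i * star (T i)‖ * ‖x‖ ^ 2 := by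
    rw [h]
    calc _ ≤ ‖x‖ * ‖(∑ i, T i * star (T i)) x‖ := norm_inner_le_norm _ _
      _ ≤ ‖x‖ * (‖∑ i, T i * star (T i)‖ * ‖x‖) := by gcongr; exact ContinuousLinearMap.le_opNorm _ _
      _ = _ := by ring
  rwa [Complex.norm_of_nonneg (Finset.sum_nonneg fun _ _ => by positivity)] at h2

/-- Splitting off the last letter gives `T_{αi}^* = T_i^* T_α^*`, so the one-letter bound applies at
the vector `T_α^* x`. -/
theorem sum_norm_star_wordProd_sq_le (T : Fin n → K →L[ℂ] K) (x : K) (k : ℕ) :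
    ∑ α ∈ wordsOfLength n k, ‖star (wordProd T α) x‖ ^ 2
      ≤ ‖∑ i, T i * star (T i)‖ ^ k * ‖x‖ ^ 2 := by
  induction k with
  | zero => rw [wordsOfLength_zero, Finset.sum_singleton, wordProd_one]; simp
  | succ k ih =>
    rw [sum_wordsOfLength_succ]
    calc _ ≤ ∑ α ∈ wordsOfLength n k,
          ‖∑ i, T i * star (T i)‖ * ‖star (wordProd T α) x‖ ^ 2 := by
          refine Finset.sum_le_sum fun α _ => ?_
          refine (Finset.sum_congr rfl fun i _ => ?_).trans_le (sum_norm_star_sq_le T _)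
          rw [wordProd_mul, wordProd_of, star_mul, mul_apply_eq_comp]
      _ ≤ _ := by
          rw [← Finset.mul_sum, pow_succ', mul_assoc]
          gcongr

theorem norm_sum_smul_wordProd_le {r : ℝ} {T : Fin n → K →L[ℂ] K} (hT : T ∈ rowBall K r)
    (c : FreeMonoid (Fin n) → ℂ) (k : ℕ) :
    ‖∑ α ∈ wordsOfLength n k, c α • wordProd T α‖
      ≤ √(∑ α ∈ wordsOfLength n k, ‖c α‖ ^ 2) * r ^ k := by
  have hr : √‖∑ i, T i * star (T i)‖ ≤ r := hT
  have hr0 : 0 ≤ r := (Real.sqrt_nonneg _).trans hr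
  -- The row condition controls `∑ ‖T_i^* x‖²`, so the adjoint is the operator to estimate.
  rw [← norm_star]
  refine ContinuousLinearMap.opNorm_le_bound _ (by positivity) fun x => ?_
  rw [star_sum, sum_apply]
  calc _ ≤ ∑ α ∈ wordsOfLength n k, ‖c α‖ * ‖star (wordProd T α) x‖ := by
        refine (norm_sum_le _ _).trans_eq (Finset.sum_congr rfl fun α _ => ?_)
        rw [star_smul, smul_apply, norm_smul, norm_star]
    _ ≤ √(∑ α ∈ wordsOfLength n k, ‖c α‖ ^ 2)
        * √(∑ α ∈ wordsOfLength n k, ‖star (wordProd T α) x‖ ^ 2) :=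
        Real.sum_mul_le_sqrt_mul_sqrt _ _ _
    _ ≤ √(∑ α ∈ wordsOfLength n k, ‖c α‖ ^ 2) * (r ^ k * ‖x‖) := by
        gcongr
        rw [Real.sqrt_le_left (by positivity)]
        refine (sum_norm_star_wordProd_sq_le T x k).trans ?_
        rw [mul_pow, ← pow_mul, mul_comm k 2, pow_mul]
        gcongr
        exact (Real.sqrt_le_left hr0).1 hr
    _ = _ := by ring

end RowBall

/-! ### Fejér's inequality for banded positive forms. -/

/-- The points `exp (iπ(2l+1)/D)`, which for `l < D` are the `D`-th roots of `-1`. -/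
noncomputable def fejerNode (D l : ℕ) : ℂ :=
  Complex.exp (((2 * l + 1) * (Real.pi / D) : ℝ) * Complex.I)

theorem norm_fejerNode (D l : ℕ) : ‖fejerNode D l‖ = 1 :=
  Complex.norm_exp_ofReal_mul_I _

theorem fejerNode_ne_zero (D l : ℕ) : fejerNode D l ≠ 0 := Complex.exp_ne_zero _

theorem fejerNode_eq (D l : ℕ) :
    fejerNode D l
      = fejerNode D 0 * Complex.exp (2 * Real.pi * Complex.I / D) ^ l := by
  rw [fejerNode, fejerNode, ← Complex.exp_nat_mul, ← Complex.exp_add]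
  congr 1
  push_cast
  ring

theorem re_fejerNode (D l : ℕ) :
    (fejerNode D l).re = Real.cos ((2 * l + 1) * (Real.pi / D)) :=
  Complex.exp_ofReal_mul_I_re _

/-- All angles lie in `[π/D, 2π - π/D]`; those beyond `π` are reflected. This makes the weights `cos
(π/D) - Re z` nonnegative. -/
theorem re_fejerNode_le {D l : ℕ} (hl : l < D) :
    (fejerNode D l).re ≤ Real.cos (Real.pi / D) := by
  have hD : (0 : ℝ) < D := by exact_mod_cast (by omega : 0 < D)
  have hl' : (l : ℝ) + 1 ≤ D := by exact_mod_cast hl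
  have hφ : 0 < Real.pi / D := div_pos Real.pi_pos hD
  have hDφ : (D : ℝ) * (Real.pi / D) = Real.pi := mul_div_cancel₀ _ hD.ne'
  rw [re_fejerNode]
  rcases le_total ((2 * l + 1) * (Real.pi / D)) Real.pi with h | h
  · exact Real.cos_le_cos_of_nonneg_of_le_pi hφ.le h
      (by nlinarith [Nat.cast_nonneg (α := ℝ) l])
  · rw [← Real.cos_two_pi_sub ((2 * l + 1) * (Real.pi / D))]
    exact Real.cos_le_cos_of_nonneg_of_le_pi hφ.le (by linarith) (by nlinarith)

theorem sum_fejerNode_zpow {D : ℕ} (hD : D ≠ 0) {p : ℤ} (hp : ¬ (D : ℤ) ∣ p) :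
    ∑ l ∈ Finset.range D, fejerNode D l ^ p = 0 := by
  have hω := Complex.isPrimitiveRoot_exp D hD
  set ω := Complex.exp (2 * Real.pi * Complex.I / D) 
  have h1 : ω ^ p ≠ 1 := fun h => hp ((hω.zpow_eq_one_iff_dvd p).1 h)
  have h2 : ∑ l ∈ Finset.range D, (ω ^ p) ^ l = 0 := by
    have h3 := geom_sum_mul (ω ^ p) D
    rw [← zpow_natCast (ω ^ p), zpow_comm, zpow_natCast, hω.pow_eq_one, one_zpow, sub_self] at h3
    exact (mul_eq_zero.1 h3).resolve_right (sub_ne_zero.2 h1)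
  rw [← mul_zero (fejerNode D 0 ^ p), ← h2, Finset.mul_sum]
  refine Finset.sum_congr rfl fun l _ => ?_
  rw [fejerNode_eq, mul_zpow, ← zpow_natCast, ← zpow_natCast, zpow_comm]

/-- The moments of the nonnegative weights `cos (π / D) - Re z` on the `D`-th roots of `-1`. -/
theorem sum_fejerWeight_mul_zpow {D : ℕ} (hD : 3 ≤ D) {p : ℤ} (hp : p.natAbs + 2 ≤ D) :
    ∑ l ∈ Finset.range D,
        ((Real.cos (Real.pi / D) - (fejerNode D l).re : ℝ) : ℂ) * fejerNode D l ^ p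
      = D * (if p = 0 then (Real.cos (Real.pi / D) : ℂ) else if p.natAbs = 1 then -1 / 2 else 0) := by
  have hS : ∀ p : ℤ, p.natAbs < D →
      ∑ l ∈ Finset.range D, fejerNode D l ^ p = if p = 0 then (D : ℂ) else 0 := by
    intro p hp
    split_ifs with h
    · simp [h]
    · exact sum_fejerNode_zpow (by omega) fun hd => h (Int.eq_zero_of_dvd_of_natAbs_lt_natAbs hd hp)
  -- On the unit circle `Re z = (z + z⁻¹)/2`, so the weight shifts exponents by one. As `|p| + 1 <
  -- D`, only exponent `0` survives summation over the nodes.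
  have hterm : ∀ l, ((Real.cos (Real.pi / D) - (fejerNode D l).re : ℝ) : ℂ) * fejerNode D l ^ p
      = (Real.cos (Real.pi / D) : ℂ) * fejerNode D l ^ p
        - (fejerNode D l ^ (p + 1) + fejerNode D l ^ (p - 1)) / 2 := by
    intro l
    have hre : ((fejerNode D l).re : ℂ) = (fejerNode D l + (fejerNode D l)⁻¹) / 2 := by
      rw [Complex.re_eq_add_conj, ← Complex.inv_eq_conj (norm_fejerNode D l)]
    rw [Complex.ofReal_sub, hre, zpow_add_one₀ (fejerNode_ne_zero D l),
      zpow_sub_one₀ (fejerNode_ne_zero D l)]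
    ring
  rw [Finset.sum_congr rfl fun l _ => hterm l, Finset.sum_sub_distrib, ← Finset.mul_sum,
    ← Finset.sum_div, Finset.sum_add_distrib, hS p (by omega), hS (p + 1) (by omega),
    hS (p - 1) (by omega)]
  by_cases h0 : p = 0
  · subst h0; norm_num [mul_comm]
  by_cases h1 : p = 1
  · subst h1; norm_num; ring
  by_cases h2 : p = -1
  · subst h2; norm_num; ring
  · rw [if_neg h0, if_neg h0, if_neg (by omega), if_neg (by omega), if_neg (by omega)]
    simp

theorem sum_range_tridiagonal (N : ℕ) (x y : ℂ) :
    ∑ i ∈ Finset.range (N + 1), ∑ j ∈ Finset.range (N + 1),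
        (if (j : ℤ) - i = 0 then x else if ((j : ℤ) - i).natAbs = 1 then y else 0)
      = (N + 1) * x + 2 * N * y := by
  have h : ∀ i j : ℕ, (if (j : ℤ) - i = 0 then x else if ((j : ℤ) - i).natAbs = 1 then y else 0)
      = (if i = j then x else 0) + (if i + 1 = j then y else 0) + (if j + 1 = i then y else 0) := by
    intro i j
    by_cases h0 : i = j
    · subst h0; simp
    by_cases h1 : i + 1 = j
    · subst h1; simp; omega
    by_cases h2 : j + 1 = i
    · subst h2; simp; omega
    · rw [if_neg (by omega), if_neg (by omega), if_neg h0, if_neg h1, if_neg h2]; simp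
  have h1 : ∑ i ∈ Finset.range (N + 1), ∑ j ∈ Finset.range (N + 1),
      (if i + 1 = j then y else 0) = N * y := by
    simp only [Finset.sum_ite_eq, Finset.mem_range]
    rw [Finset.sum_range_succ, if_neg (lt_irrefl _), add_zero,
      Finset.sum_congr rfl fun i hi => if_pos (by rw [Finset.mem_range] at hi; omega)]
    simp
  simp only [h, Finset.sum_add_distrib]
  rw [h1, Finset.sum_comm (f := fun i j => if j + 1 = i then y else 0), h1]
  have h2 : ∑ i ∈ Finset.range (N + 1), ∑ j ∈ Finset.range (N + 1),
      (if i = j then x else 0) = (N + 1) * x := by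
    simp only [Finset.sum_ite_eq]
    rw [Finset.sum_congr rfl fun i hi => if_pos hi]
    simp
  rw [h2]
  ring

/-- Fejér's inequality for the coefficients of a positive banded Toeplitz form, of which only the
three central diagonals are required to be constant. -/
theorem fejer_coeff_le {d : ℕ} (hd : 1 ≤ d) {M : ℕ → ℕ → ℂ} {c₀ c₁ : ℝ}
    (hpos : ∀ (N : ℕ) (z : ℂ), ‖z‖ = 1 →
      0 ≤ (∑ i ∈ Finset.range N, ∑ j ∈ Finset.range N, conj z ^ i * z ^ j * M i j).re)
    (h₀ : ∀ i, M i i = c₀) (h₁ : ∀ i, M (i + 1) i = c₁) (h₁' : ∀ i, M i (i + 1) = c₁)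
    (hlt : ∀ i j, i + d < j → M i j = 0) (hgt : ∀ i j, j + d < i → M i j = 0) :
    c₁ ≤ c₀ * Real.cos (Real.pi / (d + 2)) := by
  set D : ℕ := d + 2 with hD
  have hDcast : (D : ℝ) = d + 2 := by rw [hD]; push_cast; rfl
  rw [← hDcast]
  set κ := Real.cos (Real.pi / D) with hκ
  -- Averaging the form over the weighted nodes leaves a tridiagonal matrix. Inside the band `|j -
  -- i| ≤ d = D - 2` the moments are known; outside it `M` vanishes.
  have hterm : ∀ i j : ℕ, ∑ l ∈ Finset.range D, ((κ - (fejerNode D l).re : ℝ) : ℂ)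
        * (conj (fejerNode D l) ^ i * fejerNode D l ^ j * M i j)
      = D * (if (j : ℤ) - i = 0 then (κ * c₀ : ℂ) else if ((j : ℤ) - i).natAbs = 1 then -1 / 2 * c₁
        else 0) := by
    intro i j
    have hz : ∀ l, ((κ - (fejerNode D l).re : ℝ) : ℂ)
          * (conj (fejerNode D l) ^ i * fejerNode D l ^ j * M i j)
        = ((κ - (fejerNode D l).re : ℝ) : ℂ) * fejerNode D l ^ ((j : ℤ) - i) * M i j := by
      intro l
      rw [← Complex.inv_eq_conj (norm_fejerNode D l), zpow_sub₀ (fejerNode_ne_zero D l),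
        zpow_natCast, zpow_natCast, inv_pow]
      ring
    rw [Finset.sum_congr rfl fun l _ => hz l, ← Finset.sum_mul]
    by_cases hij : i + d < j ∨ j + d < i
    · have hM : M i j = 0 := hij.elim (hlt i j) (hgt i j)
      rw [hM, if_neg (by omega), if_neg (by omega)]
      simp
    · rw [sum_fejerWeight_mul_zpow (by omega) (by omega), mul_assoc]
      congr 1
      by_cases h0 : (j : ℤ) - i = 0
      · obtain rfl : i = j := by omega
        rw [h₀, sub_self, if_pos rfl, if_pos rfl]
      · rw [if_neg h0, if_neg h0]
        by_cases h1 : ((j : ℤ) - i).natAbs = 1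
        · rw [if_pos h1, if_pos h1]
          congr 1
          rcases (by omega : j = i + 1 ∨ i = j + 1) with rfl | rfl
          · exact h₁' i
          · exact h₁ j
        · rw [if_neg h1, if_neg h1, zero_mul]
  -- The section of size `N + 1` has `N + 1` diagonal entries and `N` on each adjacent diagonal; the
  -- resulting loss disappears as `N` grows.
  have hN : ∀ N : ℕ, (N : ℝ) * c₁ ≤ (N + 1) * (c₀ * κ) := by
    intro N
    have h : 0 ≤ ∑ l ∈ Finset.range D, (κ - (fejerNode D l).re)
        * (∑ i ∈ Finset.range (N + 1), ∑ j ∈ Finset.range (N + 1),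
          conj (fejerNode D l) ^ i * fejerNode D l ^ j * M i j).re :=
      Finset.sum_nonneg fun l hl => mul_nonneg
        (sub_nonneg.2 (re_fejerNode_le (Finset.mem_range.1 hl))) (hpos _ _ (norm_fejerNode D l))
    have h2 : ∑ l ∈ Finset.range D, (κ - (fejerNode D l).re)
        * (∑ i ∈ Finset.range (N + 1), ∑ j ∈ Finset.range (N + 1),
          conj (fejerNode D l) ^ i * fejerNode D l ^ j * M i j).re
        = D * ((N + 1) * (κ * c₀) - N * c₁) := by
      simp only [← Complex.re_ofReal_mul]
      rw [← Complex.re_sum]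
      simp only [Finset.mul_sum]
      rw [Finset.sum_comm]
      rw [Finset.sum_congr rfl fun i _ => Finset.sum_comm]
      simp only [hterm]
      simp only [← Finset.mul_sum]
      rw [sum_range_tridiagonal]
      rw [show (D : ℂ) * (((N : ℂ) + 1) * (κ * c₀) + 2 * N * (-1 / 2 * c₁))
        = ((D * ((N + 1) * (κ * c₀) - N * c₁) : ℝ) : ℂ) by push_cast; ring, Complex.ofReal_re]
    rw [h2] at h
    have hDpos : (0 : ℝ) < D := by rw [hDcast]; positivity
    have := nonneg_of_mul_nonneg_right h hDpos
    linarith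
  by_contra! hlt'
  obtain ⟨N, hN'⟩ := exists_nat_gt ((c₀ * κ) / (c₁ - c₀ * κ))
  rw [div_lt_iff₀ (by linarith)] at hN'
  linarith [hN N]

/-! ### Graded structure of Fock space and tensor powers. -/

/-- The span of the elementary tensors of order `k` in the full Fock space. -/
noncomputable def fockLevel (n k : ℕ) : Submodule ℂ (FockSpace n) :=
  Submodule.span ℂ (fockBasis '' {α : FreeMonoid (Fin n) | α.length = k})

theorem inner_vacuum_self (n : ℕ) :
    ⟪(fockBasis 1 : FockSpace n), (fockBasis 1 : FockSpace n)⟫_ℂ = 1 := by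
  rw [inner_self_eq_norm_sq_to_K, (orthonormal_fockBasis n).1]
  simp

theorem fockBasis_mem_fockLevel {n : ℕ} (α : FreeMonoid (Fin n)) :
    fockBasis α ∈ fockLevel n α.length :=
  Submodule.subset_span ⟨α, rfl, rfl⟩

theorem wordProd_creation_fockBasis {n : ℕ} (α β : FreeMonoid (Fin n)) :
    wordProd creation α (fockBasis β) = fockBasis (α * β) := by
  induction α using FreeMonoid.recOn with
  | one => rw [wordProd_one, one_mul]; rfl
  | of_mul i α ih =>
    rw [wordProd_mul, wordProd_of, mul_apply_eq_comp, ih, creation_fockBasis, mul_assoc]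

theorem wordProd_creation_mem_fockLevel {n j : ℕ} (α : FreeMonoid (Fin n)) {x : FockSpace n}
    (hx : x ∈ fockLevel n j) : wordProd creation α x ∈ fockLevel n (α.length + j) := by
  induction hx using Submodule.span_induction with
  | mem x h =>
    obtain ⟨β, hβ, rfl⟩ := h
    rw [wordProd_creation_fockBasis, ← (show β.length = j from hβ), ← FreeMonoid.length_mul]
    exact fockBasis_mem_fockLevel _
  | zero => rw [map_zero]; exact zero_mem _
  | add x y _ _ hx hy => rw [map_add]; exact add_mem hx hy
  | smul c x _ hx => rw [map_smul]; exact Submodule.smul_mem _ c hx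

theorem inner_eq_zero_of_mem_fockLevel {n j k : ℕ} (hjk : j ≠ k) {x y : FockSpace n}
    (hx : x ∈ fockLevel n j) (hy : y ∈ fockLevel n k) : ⟪x, y⟫_ℂ = 0 := by
  have h : fockLevel n j ⟂ fockLevel n k := by
    rw [fockLevel, fockLevel, Submodule.isOrtho_span]
    rintro _ ⟨α, hα, rfl⟩ _ ⟨β, hβ, rfl⟩
    refine (orthonormal_fockBasis n).2 ?_
    rintro rfl
    exact hjk (hα.symm.trans hβ)
  exact Submodule.isOrtho_iff_inner_eq.1 h x hx y hy

open Classical in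
-- This is `S_α^* S_β = δ_{αβ} I` for words of equal length: on basis vectors, `αγ = βδ` forces `α =
-- β` and `γ = δ`. Membership in levels reduces the claim to basis vectors.
theorem inner_wordProd_creation {n j k : ℕ} {α β : FreeMonoid (Fin n)}
    (h : α.length = β.length) {x y : FockSpace n} (hx : x ∈ fockLevel n j)
    (hy : y ∈ fockLevel n k) :
    ⟪wordProd creation α x, wordProd creation β y⟫_ℂ = if α = β then ⟪x, y⟫_ℂ else 0 := by
  induction hx using Submodule.span_induction with
  | mem x hx =>
    obtain ⟨γ, -, rfl⟩ := hx
    induction hy using Submodule.span_induction with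
    | mem y hy =>
      obtain ⟨δ, -, rfl⟩ := hy
      rw [wordProd_creation_fockBasis, wordProd_creation_fockBasis,
        orthonormal_iff_ite.1 (orthonormal_fockBasis n),
        orthonormal_iff_ite.1 (orthonormal_fockBasis n), ← ite_and]
      refine if_congr ⟨fun hαβ => List.append_inj hαβ h, ?_⟩ rfl rfl
      rintro ⟨rfl, rfl⟩
      rfl
    | zero => simp
    | add x y _ _ hx hy => rw [map_add, inner_add_right, hx, hy, inner_add_right]; split_ifs <;> simp
    | smul c x _ hx => rw [map_smul, inner_smul_right, hx, inner_smul_right]; split_ifs <;> simp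
  | zero => simp
  | add x y _ _ hx hy => rw [map_add, inner_add_left, hx, hy, inner_add_left]; split_ifs <;> simp
  | smul c x _ hx => rw [map_smul, inner_smul_left, hx, inner_smul_left]; split_ifs <;> simp

/-- The powers `q^{⊗ j}` of the tensor `q = ∑_{|α| = k} q_α e_α`. -/
noncomputable def tensorPow {n : ℕ} (k : ℕ) (q : FreeMonoid (Fin n) → ℂ) : ℕ → FockSpace n
  | 0 => fockBasis 1
  | j + 1 => ∑ α ∈ wordsOfLength n k, q α • wordProd creation α (tensorPow k q j)

section TensorPow

variable {n k : ℕ} {q : FreeMonoid (Fin n) → ℂ}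

theorem tensorPow_mem_fockLevel (k : ℕ) (q : FreeMonoid (Fin n) → ℂ) (j : ℕ) :
    tensorPow k q j ∈ fockLevel n (j * k) := by
  induction j with
  | zero => rw [zero_mul]; exact fockBasis_mem_fockLevel 1
  | succ j ih =>
    refine Submodule.sum_mem _ fun α hα => Submodule.smul_mem _ _ ?_
    rw [mem_wordsOfLength] at hα
    have := wordProd_creation_mem_fockLevel α ih
    rwa [hα, show k + j * k = (j + 1) * k by ring] at this

/-- Among the summands of `q ⊗ q^{⊗ j}`, only the one with first block `α` is not orthogonal to the
range of `S_α`. -/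
theorem inner_tensorPow_succ_wordProd (j : ℕ) {α : FreeMonoid (Fin n)} (hα : α.length = k)
    {l : ℕ} {y : FockSpace n} (hy : y ∈ fockLevel n l) :
    ⟪tensorPow k q (j + 1), wordProd creation α y⟫_ℂ = conj (q α) * ⟪tensorPow k q j, y⟫_ℂ := by
  classical
  rw [tensorPow, sum_inner, Finset.sum_eq_single α]
  · rw [inner_smul_left, inner_wordProd_creation rfl (tensorPow_mem_fockLevel k q j) hy, if_pos rfl]
  · intro β hβ hne
    rw [mem_wordsOfLength] at hβ
    rw [inner_smul_left, inner_wordProd_creation (hβ.trans hα.symm)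
      (tensorPow_mem_fockLevel k q j) hy, if_neg hne, mul_zero]
  · intro h
    exact absurd (mem_wordsOfLength.2 hα) h

theorem inner_tensorPow_self (hq : ∑ α ∈ wordsOfLength n k, ‖q α‖ ^ 2 = 1) (j : ℕ) :
    ⟪tensorPow k q j, tensorPow k q j⟫_ℂ = 1 := by
  induction j with
  | zero => exact inner_vacuum_self n
  | succ j ih =>
    have h : ⟪tensorPow k q (j + 1), tensorPow k q (j + 1)⟫_ℂ
        = ∑ α ∈ wordsOfLength n k, ((‖q α‖ ^ 2 : ℝ) : ℂ) := by
      nth_rewrite 2 [tensorPow]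
      rw [inner_sum]
      refine Finset.sum_congr rfl fun α hα => ?_
      rw [inner_smul_right, inner_tensorPow_succ_wordProd j (mem_wordsOfLength.1 hα)
        (tensorPow_mem_fockLevel k q j), ih, mul_one, Complex.mul_conj, Complex.normSq_eq_norm_sq]
    rw [h, ← Complex.ofReal_sum, hq, Complex.ofReal_one]

end TensorPow

/-! ### Matrix entries of `H` and the coefficient bound. -/

section Harmonic

variable {n : ℕ}

/-- The analytic part `∑_{1≤|α|≤m-1} a_α S_α` as an operator on the full Fock space. -/
noncomputable def analyticPart (m : ℕ) (a : FreeMonoid (Fin n) → ℂ) : FockSpace n →L[ℂ] FockSpace n :=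
  ∑ k ∈ Finset.Icc 1 (m - 1), ∑ α ∈ wordsOfLength n k, a α • wordProd creation α

theorem coe_harmonicPoly (m : ℕ) (a : FreeMonoid (Fin n) → ℂ) :
    ((harmonicPoly m a : CuntzToeplitz n) : FockSpace n →L[ℂ] FockSpace n)
      = star (analyticPart m a) + a 1 • 1 + analyticPart m a := by
  have hw : ∀ α : FreeMonoid (Fin n), ((wordProd ctGen α : CuntzToeplitz n) :
      FockSpace n →L[ℂ] FockSpace n) = wordProd creation α := fun α =>
    map_wordProd (CuntzToeplitz n).subtype ctGen α
  change (CuntzToeplitz n).subtype (harmonicPoly m a) = _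
  simp only [harmonicPoly, analyticPart, map_add, map_sum, map_smul, map_star, map_one, star_sum,
    star_smul]
  simp only [StarSubalgebra.subtype_apply, hw]
  rfl

theorem inner_analyticPart (m : ℕ) (a : FreeMonoid (Fin n) → ℂ) (x y : FockSpace n) :
    ⟪x, analyticPart m a y⟫_ℂ = ∑ k ∈ Finset.Icc 1 (m - 1), ∑ α ∈ wordsOfLength n k,
      a α * ⟪x, wordProd creation α y⟫_ℂ := by
  simp only [analyticPart, sum_apply, smul_apply, inner_sum,
    inner_smul_right]

/-- The analytic part raises degree by some `l` with `1 ≤ l ≤ m - 1`, and distinct levels are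
orthogonal. -/
theorem inner_analyticPart_eq_zero (m : ℕ) (a : FreeMonoid (Fin n) → ℂ) {i j : ℕ}
    (h : ∀ l, 1 ≤ l → l ≤ m - 1 → l + j ≠ i) {x y : FockSpace n}
    (hx : x ∈ fockLevel n i) (hy : y ∈ fockLevel n j) : ⟪x, analyticPart m a y⟫_ℂ = 0 := by
  rw [inner_analyticPart]
  refine Finset.sum_eq_zero fun l hl => Finset.sum_eq_zero fun α hα => ?_
  rw [Finset.mem_Icc] at hl
  rw [mem_wordsOfLength] at hα
  rw [inner_eq_zero_of_mem_fockLevel (h l hl.1 hl.2).symm hx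
    (hα ▸ wordProd_creation_mem_fockLevel α hy), mul_zero]

/-- Only the degree-`k` component maps level `jk` to level `(j+1)k`; the value is independent of
`j`, as Fejér's inequality needs. -/
theorem inner_analyticPart_tensorPow {m k : ℕ} (hk : 1 ≤ k) (hkm : k ≤ m - 1)
    (a : FreeMonoid (Fin n) → ℂ) {q : FreeMonoid (Fin n) → ℂ}
    (hq : ∑ α ∈ wordsOfLength n k, ‖q α‖ ^ 2 = 1) (j : ℕ) :
    ⟪tensorPow k q (j + 1), analyticPart m a (tensorPow k q j)⟫_ℂ
      = ∑ α ∈ wordsOfLength n k, a α * conj (q α) := by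
  rw [inner_analyticPart, Finset.sum_eq_single k]
  · refine Finset.sum_congr rfl fun α hα => ?_
    rw [inner_tensorPow_succ_wordProd j (mem_wordsOfLength.1 hα) (tensorPow_mem_fockLevel k q j),
      inner_tensorPow_self hq, mul_one]
  · intro l _ hlk
    refine Finset.sum_eq_zero fun α hα => ?_
    rw [mem_wordsOfLength] at hα
    rw [inner_eq_zero_of_mem_fockLevel _ (tensorPow_mem_fockLevel k q (j + 1))
      (wordProd_creation_mem_fockLevel α (tensorPow_mem_fockLevel k q j)), mul_zero]
    rw [hα, add_mul, one_mul]
    omega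
  · intro h
    exact absurd (Finset.mem_Icc.2 ⟨hk, hkm⟩) h

theorem inner_harmonicPoly (m : ℕ) (a : FreeMonoid (Fin n) → ℂ) (x y : FockSpace n) :
    ⟪x, (harmonicPoly m a).1 y⟫_ℂ
      = conj ⟪y, analyticPart m a x⟫_ℂ + a 1 * ⟪x, y⟫_ℂ + ⟪x, analyticPart m a y⟫_ℂ := by
  rw [coe_harmonicPoly, add_apply, add_apply,
    inner_add_right, inner_add_right, smul_apply, inner_smul_right,
    ContinuousLinearMap.star_eq_adjoint, ContinuousLinearMap.adjoint_inner_right, inner_conj_symm]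
  rfl

theorem inner_vacuum_harmonicPoly (m : ℕ) (a : FreeMonoid (Fin n) → ℂ) :
    ⟪fockBasis 1, (harmonicPoly m a).1 (fockBasis 1)⟫_ℂ = a 1 := by
  have h1 : (fockBasis 1 : FockSpace n) ∈ fockLevel n 0 := fockBasis_mem_fockLevel 1
  rw [inner_harmonicPoly, inner_analyticPart_eq_zero m a (by omega) h1 h1,
    inner_vacuum_self]
  simp

theorem conj_coeff_one {m : ℕ} {a : FreeMonoid (Fin n) → ℂ}
    (hsa : IsSelfAdjoint (harmonicPoly m a)) : conj (a 1) = a 1 := by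
  have h : star (harmonicPoly m a).1 = harmonicPoly m a :=
    congrArg Subtype.val hsa.star_eq
  conv_rhs => rw [← inner_vacuum_harmonicPoly m a, ← h, ContinuousLinearMap.star_eq_adjoint,
    ContinuousLinearMap.adjoint_inner_right, ← inner_conj_symm, inner_vacuum_harmonicPoly]

theorem norm_coeff_one_le {m : ℕ} {a : FreeMonoid (Fin n) → ℂ} (hn : ‖harmonicPoly m a‖ ≤ 1) :
    ‖a 1‖ ≤ 1 := by
  have h1 : ‖(fockBasis 1 : FockSpace n)‖ = 1 := (orthonormal_fockBasis n).1 1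
  rw [← inner_vacuum_harmonicPoly m a]
  calc _ ≤ _ := norm_inner_le_norm _ _
    _ ≤ 1 * (‖harmonicPoly m a‖ * 1) := by
      rw [h1]
      gcongr
      refine (ContinuousLinearMap.le_opNorm _ _).trans_eq ?_
      rw [h1]
      rfl
    _ ≤ 1 := by linarith

theorem sqrt_sum_coeff_le_of_sign {m k : ℕ} (hk : 1 ≤ k) (hkm : k ≤ m - 1)
    {a : FreeMonoid (Fin n) → ℂ} (hsa : IsSelfAdjoint (harmonicPoly m a))
    (hn : ‖harmonicPoly m a‖ ≤ 1) {ε : ℝ} (hε : |ε| = 1)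
    (hβ : 0 < √(∑ α ∈ wordsOfLength n k, ‖a α‖ ^ 2)) :
    √(∑ α ∈ wordsOfLength n k, ‖a α‖ ^ 2) ≤ (1 + ε * (a 1).re) * fejerCos m k := by
  set β := √(∑ α ∈ wordsOfLength n k, ‖a α‖ ^ 2) with hβ_def
  have hβ2 : ∑ α ∈ wordsOfLength n k, ‖a α‖ ^ 2 = β ^ 2 := by
    rw [hβ_def, Real.sq_sqrt (Finset.sum_nonneg fun _ _ => by positivity)]
  have hε2 : ε * ε = 1 := by rw [← abs_mul_abs_self, hε, one_mul]
  have ha1 : a 1 = ((a 1).re : ℂ) := (Complex.conj_eq_iff_re.1 (conj_coeff_one hsa)).symm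
  -- Dividing by `β` makes `q` a unit tensor; the factor `ε` cancels the one in `I + εH`, so the
  -- adjacent entries become `ε · εβ = β`.
  set q : FreeMonoid (Fin n) → ℂ := fun α => ((ε / β : ℝ) : ℂ) * a α with hq_def
  have hq : ∑ α ∈ wordsOfLength n k, ‖q α‖ ^ 2 = 1 := by
    simp only [hq_def, norm_mul, mul_pow, Complex.norm_real, Real.norm_eq_abs, sq_abs]
    rw [← Finset.mul_sum, hβ2, div_pow, pow_two ε, hε2]
    field_simp
  have hqa : ∑ α ∈ wordsOfLength n k, a α * conj (q α) = ((ε * β : ℝ) : ℂ) := by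
    have : ∀ α, a α * conj (q α) = ((ε / β * ‖a α‖ ^ 2 : ℝ) : ℂ) := by
      intro α
      rw [hq_def, map_mul, Complex.conj_ofReal, mul_left_comm, Complex.mul_conj,
        Complex.normSq_eq_norm_sq, Complex.ofReal_mul]
    rw [Finset.sum_congr rfl fun α _ => this α, ← Complex.ofReal_sum, ← Finset.mul_sum, hβ2]
    congr 1
    field_simp
  set u := tensorPow k q with hu
  have hu_mem : ∀ j, u j ∈ fockLevel n (j * k) := tensorPow_mem_fockLevel k q
  set Hop : FockSpace n →L[ℂ] FockSpace n := (harmonicPoly m a).1 with hHop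
  set M : ℕ → ℕ → ℂ := fun i j => ⟪u i, u j⟫_ℂ + ε * ⟪u i, Hop (u j)⟫_ℂ with hM
  have hne : ∀ {i j : ℕ}, i ≠ j → i * k ≠ j * k := fun h h' =>
    h (Nat.eq_of_mul_eq_mul_right hk h')
  have hzero : ∀ i j, (∀ l, 1 ≤ l → l ≤ m - 1 → l + j * k ≠ i * k) →
      ⟪u i, analyticPart m a (u j)⟫_ℂ = 0 := fun i j h =>
    inner_analyticPart_eq_zero m a h (hu_mem i) (hu_mem j)
  have hle : ∀ {i j : ℕ}, i ≤ j → ∀ l, 1 ≤ l → l ≤ m - 1 → l + j * k ≠ i * k := by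
    intro i j h l hl _
    have := Nat.mul_le_mul_right k h
    omega
  -- The least gap `i - j` allowed is `[(m-1)/k] + 1`, and `k` times it exceeds `m - 1`.
  have hfar : ∀ {i j : ℕ}, j + (m - 1) / k < i → ∀ l, 1 ≤ l → l ≤ m - 1 → l + j * k ≠ i * k := by
    intro i j h l _ hl
    have h1 := Nat.mul_le_mul_right k (Nat.succ_le_of_lt h)
    have h2 := Nat.lt_div_mul_add (a := m - 1) hk
    have h3 : (j + (m - 1) / k).succ * k = j * k + ((m - 1) / k * k + k) := by
      rw [Nat.succ_eq_add_one]; ring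
    omega
  have hMoff : ∀ {i j : ℕ}, i ≠ j → M i j
      = ε * (conj ⟪u j, analyticPart m a (u i)⟫_ℂ + ⟪u i, analyticPart m a (u j)⟫_ℂ) := by
    intro i j h
    simp only [hM, hHop]
    rw [inner_harmonicPoly, inner_eq_zero_of_mem_fockLevel (hne h) (hu_mem i) (hu_mem j)]
    ring
  refine fejer_coeff_le ((Nat.one_le_div_iff hk).2 hkm) (M := M) ?_ ?_ ?_ ?_ ?_ ?_
  · intro N z _
    set h := ∑ j ∈ Finset.range N, z ^ j • u j with hh
    -- The form at `z` is `⟨h, (I + εH)h⟩`, whose real part is nonnegative because `‖H‖ ≤ 1`.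
    have hsum : ∑ i ∈ Finset.range N, ∑ j ∈ Finset.range N, conj z ^ i * z ^ j * M i j
        = ⟪h, h⟫_ℂ + ε * ⟪h, Hop h⟫_ℂ := by
      have e : ∀ G : FockSpace n →L[ℂ] FockSpace n, ⟪h, G h⟫_ℂ
          = ∑ i ∈ Finset.range N, ∑ j ∈ Finset.range N,
            conj z ^ i * z ^ j * ⟪u i, G (u j)⟫_ℂ := by
        intro G
        rw [hh, sum_inner]
        refine Finset.sum_congr rfl fun i _ => ?_
        rw [inner_smul_left, map_sum, inner_sum, Finset.mul_sum]
        refine Finset.sum_congr rfl fun j _ => ?_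
        rw [map_smul, inner_smul_right, map_pow]
        ring
      have e1 : ⟪h, h⟫_ℂ = ∑ i ∈ Finset.range N, ∑ j ∈ Finset.range N,
          conj z ^ i * z ^ j * ⟪u i, u j⟫_ℂ := e 1
      rw [e1, e Hop, Finset.mul_sum, ← Finset.sum_add_distrib]
      refine Finset.sum_congr rfl fun i _ => ?_
      rw [Finset.mul_sum, ← Finset.sum_add_distrib]
      exact Finset.sum_congr rfl fun j _ => by simp only [hM]; ring
    rw [hsum, Complex.add_re, Complex.re_ofReal_mul]
    have h1 : (⟪h, h⟫_ℂ).re = ‖h‖ ^ 2 := inner_self_eq_norm_sq (𝕜 := ℂ) h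
    have h2 : |ε * (⟪h, Hop h⟫_ℂ).re| ≤ ‖h‖ ^ 2 := by
      rw [abs_mul, hε, one_mul]
      calc _ ≤ ‖⟪h, Hop h⟫_ℂ‖ := Complex.abs_re_le_norm _
        _ ≤ ‖h‖ * ‖Hop h‖ := norm_inner_le_norm _ _
        _ ≤ ‖h‖ * (1 * ‖h‖) := by
          gcongr
          exact Hop.le_of_opNorm_le hn h
        _ = _ := by ring
    linarith [neg_abs_le (ε * (⟪h, Hop h⟫_ℂ).re)]
  · intro i
    simp only [hM, hHop]
    rw [inner_harmonicPoly, hzero i i (hle le_rfl), hu, inner_tensorPow_self hq]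
    conv_lhs => rw [ha1]
    simp
  · intro i
    rw [hMoff (by omega), hzero i (i + 1) (hle (by omega)), hu,
      inner_analyticPart_tensorPow hk hkm a hq, hqa, map_zero, zero_add, ← Complex.ofReal_mul,
      ← mul_assoc, hε2, one_mul]
  · intro i
    rw [hMoff (by omega), hzero i (i + 1) (hle (by omega)), hu,
      inner_analyticPart_tensorPow hk hkm a hq, hqa, Complex.conj_ofReal, add_zero,
      ← Complex.ofReal_mul, ← mul_assoc, hε2, one_mul]
  · intro i j hij
    have hlt : i < j := (Nat.le_add_right _ _).trans_lt hij
    rw [hMoff hlt.ne, hzero j i (hfar hij), hzero i j (hle hlt.le)]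
    simp
  · intro i j hij
    have hlt : j < i := (Nat.le_add_right _ _).trans_lt hij
    rw [hMoff hlt.ne', hzero i j (hfar hij), hzero j i (hle hlt.le)]
    simp

/-- The coefficient estimate for selfadjoint contractive noncommutative trigonometric
polynomials. -/
theorem sqrt_sum_coeff_le {m k : ℕ} (hk : 1 ≤ k) (hkm : k ≤ m - 1)
    {a : FreeMonoid (Fin n) → ℂ} (hsa : IsSelfAdjoint (harmonicPoly m a))
    (hn : ‖harmonicPoly m a‖ ≤ 1) :
    √(∑ α ∈ wordsOfLength n k, ‖a α‖ ^ 2) ≤ (1 - ‖a 1‖) * fejerCos m k := by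
  -- The degenerate case `β = 0` is separate, since `q` cannot be normalised there.
  rcases (Real.sqrt_nonneg (∑ α ∈ wordsOfLength n k, ‖a α‖ ^ 2)).eq_or_lt with h | h
  · rw [← h]
    exact mul_nonneg (sub_nonneg.2 (norm_coeff_one_le hn)) (fejerCos_pos hk hkm).le
  · have h1 : ‖a 1‖ = |(a 1).re| := by
      rw [← (Complex.conj_eq_iff_re.1 (conj_coeff_one hsa)), Complex.norm_real, Complex.ofReal_re,
        Real.norm_eq_abs]
    rw [h1]
    -- The sign `ε` is opposite to that of `a₀`.
    rcases abs_cases (a 1).re with ⟨h2, _⟩ | ⟨h2, _⟩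
    · have := sqrt_sum_coeff_le_of_sign hk hkm hsa hn (ε := -1) (by simp) h
      rwa [h2, sub_eq_add_neg, ← neg_one_mul]
    · have := sqrt_sum_coeff_le_of_sign hk hkm hsa hn (ε := 1) (by simp) h
      rwa [h2, sub_neg_eq_add, ← one_mul (a 1).re]

end Harmonic

/-! ### Assembly of the inequalities. -/

/-- Common to the operator and scalar inequalities: with `c = 1` the bound `1 - |a₀|` complements
the constant term, and with `c = 1/2` two copies do. -/
theorem sum_le_of_le_sqrt_sum_coeff_mul_pow {n m : ℕ} {a : FreeMonoid (Fin n) → ℂ}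
    (hsa : IsSelfAdjoint (harmonicPoly m a)) (hn : ‖harmonicPoly m a‖ ≤ 1) {s c : ℝ} (hs : 0 ≤ s)
    (hsum : fejerSum m s = c) {v : ℕ → ℝ}
    (hv : ∀ k, v k ≤ √(∑ α ∈ wordsOfLength n k, ‖a α‖ ^ 2) * s ^ k) :
    ∑ k ∈ Finset.Icc 1 (m - 1), v k ≤ (1 - ‖a 1‖) * c := by
  rw [← hsum, fejerSum, Finset.mul_sum]
  refine Finset.sum_le_sum fun k hk => (hv k).trans ?_
  rw [Finset.mem_Icc] at hk
  rw [mul_left_comm, mul_comm]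
  exact mul_le_mul_of_nonneg_left (sqrt_sum_coeff_le hk.1 hk.2 hsa hn) (pow_nonneg hs k)

theorem sum_range_eq_add_sum_Icc {M : Type*} [AddCommMonoid M] {m : ℕ} (hm : 1 ≤ m) (v : ℕ → M) :
    ∑ k ∈ Finset.range m, v k = v 0 + ∑ k ∈ Finset.Icc 1 (m - 1), v k := by
  obtain ⟨m, rfl⟩ := Nat.exists_eq_add_of_le' hm
  rw [Nat.add_sub_cancel, Finset.range_eq_Ico, Finset.sum_eq_sum_Ico_succ_bot (by omega)]
  rfl

theorem theorem1p8 :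
    ∃ γ t : ℕ → ℝ,
      -- `γ m` is the unique positive solution of the equation with right side `1`
      (∀ m, 2 ≤ m → 0 < γ m ∧ fejerSum m (γ m) = 1 ∧
        ∀ s : ℝ, 0 < s → fejerSum m s = 1 → s = γ m) ∧
      γ 2 = 2 ∧ (∀ m, 3 ≤ m → γ m ≤ 1) ∧
      StrictAntiOn γ (Set.Ici 2) ∧
      Filter.Tendsto γ Filter.atTop (nhds (1 / 2)) ∧
      -- `t m` is the unique positive solution of the equation with right side `1 / 2`
      (∀ m, 2 ≤ m → 0 < t m ∧ fejerSum m (t m) = 1 / 2 ∧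
        ∀ s : ℝ, 0 < s → fejerSum m s = 1 / 2 → s = t m) ∧
      (∀ m, 2 ≤ m → t m ≤ 1) ∧
      StrictAntiOn t (Set.Ici 2) ∧
      Filter.Tendsto t Filter.atTop (nhds (1 / 3)) ∧
      -- the inequalities
      ∀ (n : ℕ), 1 ≤ n → ∀ (m : ℕ), 2 ≤ m → ∀ (a : FreeMonoid (Fin n) → ℂ),
        IsSelfAdjoint (harmonicPoly m a) → ‖harmonicPoly m a‖ ≤ 1 →
        (∀ k, 1 ≤ k → k ≤ m - 1 →
          √(∑ α ∈ wordsOfLength n k, ‖a α‖ ^ 2) ≤ (1 - ‖a 1‖) * fejerCos m k) ∧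
        (∀ (K : Type*) [NormedAddCommGroup K] [InnerProductSpace ℂ K] [CompleteSpace K]
          (T : Fin n → K →L[ℂ] K), T ∈ rowBall K (γ m) →
          ∑ k ∈ Finset.range m,
            ‖∑ α ∈ wordsOfLength n k, ((‖a α‖ : ℝ) : ℂ) • wordProd T α‖ ≤ 1) ∧
        (∀ (K : Type*) [NormedAddCommGroup K] [InnerProductSpace ℂ K] [CompleteSpace K]
          (T : Fin n → K →L[ℂ] K), T ∈ rowBall K (t m) →
          (∑ k ∈ Finset.Icc 1 (m - 1),
              ‖∑ α ∈ wordsOfLength n k, ((‖conj (a α)‖ : ℝ) : ℂ) • star (wordProd T α)‖)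
            + ‖a 1‖
            + (∑ k ∈ Finset.Icc 1 (m - 1),
              ‖∑ α ∈ wordsOfLength n k, ((‖a α‖ : ℝ) : ℂ) • wordProd T α‖) ≤ 1) ∧
        (∀ r : EuclideanSpace ℝ (Fin n), (∀ i, 0 ≤ r i) → ‖r‖ ≤ γ m →
          ∑ k ∈ Finset.range m, ∑ α ∈ wordsOfLength n k,
            ‖a α‖ * wordProd (fun i => r i) α ≤ 1) ∧
        (∀ r : EuclideanSpace ℝ (Fin n), (∀ i, 0 ≤ r i) → ‖r‖ ≤ t m →
          ‖a 1‖ + 2 * ∑ k ∈ Finset.Icc 1 (m - 1), ∑ α ∈ wordsOfLength n k,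
            ‖a α‖ * wordProd (fun i => r i) α ≤ 1) := by
  have h12 : (0 : ℝ) < 1 / 2 := by norm_num
  refine ⟨fejerRoot 1, fejerRoot (1 / 2), fun m hm => ?_, ?_, fun m hm => ?_,
    strictAntiOn_fejerRoot one_pos, ?_, fun m hm => ?_, fun m hm => ?_,
    strictAntiOn_fejerRoot h12, ?_, ?_⟩
  · exact ⟨(fejerRoot_spec one_pos hm).1, (fejerRoot_spec one_pos hm).2,
      fun s hs h => eq_fejerRoot one_pos hm hs h⟩
  · exact (eq_fejerRoot one_pos le_rfl two_pos (by rw [fejerSum_two]; norm_num)).symm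
  · exact fejerRoot_le one_pos (by omega) zero_le_one (one_le_fejerSum_one hm)
  · have h := tendsto_fejerRoot one_pos
    norm_num at h ⊢
    exact h
  · exact ⟨(fejerRoot_spec h12 hm).1, (fejerRoot_spec h12 hm).2,
      fun s hs h => eq_fejerRoot h12 hm hs h⟩
  · exact fejerRoot_le h12 hm zero_le_one (half_le_fejerSum hm zero_le_one)
  · have h := tendsto_fejerRoot h12
    norm_num at h ⊢
    exact h
  intro n _ m hm a hsa hn
  obtain ⟨hγ0, hγ⟩ := fejerRoot_spec one_pos hm
  obtain ⟨ht0, ht⟩ := fejerRoot_spec h12 hm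
  refine ⟨fun k hk hkm => sqrt_sum_coeff_le hk hkm hsa hn, ?_, ?_, ?_, ?_⟩
  · intro K _ _ _ T hT
    rw [sum_range_eq_add_sum_Icc (by omega), wordsOfLength_zero, Finset.sum_singleton,
      wordProd_one]
    -- Only `≤` is available, since the identity has norm `0` when `K` is trivial.
    have h0 : ‖((‖a 1‖ : ℝ) : ℂ) • (1 : K →L[ℂ] K)‖ ≤ ‖a 1‖ := by
      rw [norm_smul, Complex.norm_real, norm_norm]
      exact mul_le_of_le_one_right (norm_nonneg _) ContinuousLinearMap.norm_id_le
    have h1 := sum_le_of_le_sqrt_sum_coeff_mul_pow hsa hn hγ0.le hγ fun k =>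
      (norm_sum_smul_wordProd_le hT (fun α => ((‖a α‖ : ℝ) : ℂ)) k).trans_eq
        (by simp only [Complex.norm_real, norm_norm])
    linarith
  · intro K _ _ _ T hT
    have h1 := sum_le_of_le_sqrt_sum_coeff_mul_pow hsa hn ht0.le ht fun k =>
      (norm_sum_smul_wordProd_le hT (fun α => ((‖a α‖ : ℝ) : ℂ)) k).trans_eq
        (by simp only [Complex.norm_real, norm_norm])
    -- The coefficients are real, so the two polynomials are adjoint to each other and have equal
    -- norms.
    have h2 : ∀ k, ‖∑ α ∈ wordsOfLength n k, ((‖conj (a α)‖ : ℝ) : ℂ) • star (wordProd T α)‖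
        = ‖∑ α ∈ wordsOfLength n k, ((‖a α‖ : ℝ) : ℂ) • wordProd T α‖ := by
      intro k
      rw [← norm_star, star_sum]
      simp only [star_smul, star_star, RCLike.norm_conj, Complex.star_def, Complex.conj_ofReal]
    simp only [h2]
    linarith
  · intro r _ hr
    rw [sum_range_eq_add_sum_Icc (by omega), wordsOfLength_zero, Finset.sum_singleton,
      wordProd_one, mul_one]
    have h1 := sum_le_of_le_sqrt_sum_coeff_mul_pow hsa hn hγ0.le hγ fun k =>
      (sum_mul_wordProd_le r (fun α => ‖a α‖) k).trans (by gcongr)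
    linarith
  · intro r _ hr
    have h1 := sum_le_of_le_sqrt_sum_coeff_mul_pow hsa hn ht0.le ht fun k =>
      (sum_mul_wordProd_le r (fun α => ‖a α‖) k).trans (by gcongr)
    linarith
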